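/- Let $n\ge 2$ and let $(B_n,S)$ be a Coxeter system of type $B_n$, with $S=\{s_1,\dots,s_n\}$ ordered so that $m(s_1,s_2)=4$, $m(s_i,s_{i+1})=3$ for $2\le i\le n-1$, and $m(s_i,s_j)=2$ for $|i-j|\ge 2$. Let $\ell$ be the length function, and for $1\le i\le n$ let $$Q_i={}^{\{s_1,\dots,s_{i-1}\}}(B_n)_{\{s_1,\dots,s_i\}}=\{w\in\langle s_1,\dots,s_i\rangle : \ell(s_jw)>\ell(w)\ \text{for all } 1\le j\le i-1\}.$$ Every $w\in B_n$ has a unique factorization $w=w^{(1)}w^{(2)}\cdots w^{(n)}$ with $w^{(i)}\in Q_i$ for all $i$, and $\ell(w)=\sum_{i=1}^n\ell(w^{(i)})$. The map $$L_{B_n}:B_n\to\prod_{i=1}^n\{0,\dots,2i-1\},\qquad L_{B_n}(w)=(\ell(w^{(1)}),\dots,\ell(w^{(n)})),$$ is well defined and is a Lehmer code for $(B_n,S)$. That is: $B_n$ is finite; its exponents are $1,3,\dots,2n-1$, meaning that $\sum_{w\in B_n}q^{\ell(w)}=\prod_{i=1}^n(1+q+\cdots+q^{2i-1})$; $L_{B_n}$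 is a bijection; and $L_{B_n}^{-1}$ is order preserving, i.e. if $a_i\le b_i$ for all $i$ then $L_{B_n}^{-1}(a)\le L_{B_n}^{-1}(b)$ in the Bruhat order. Here $u\le v$ in the Bruhat order means that some reduced word of $v$ has a subword that is a reduced word of $u$. -/

import Mathlib

namespace LehmerCode

open Polynomial

/-- The Coxeter matrix of type `B_n`, with the generators numbered along the Coxeter graph
```
        4
    s_1 --- s_2 --- s_3 ⬝ ⬝ ⬝ s_n
```
(the index `i : Fin n` stands for `s_{i+1}`). Mathlib's `CoxeterMatrix.B` has the edge labelled `4`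
at the other end, so its numbering is reversed; see `typeB_apply` for the entries. -/
def typeB (n : ℕ) : CoxeterMatrix (Fin n) :=
  (CoxeterMatrix.B n).reindex Fin.revPerm

theorem typeB_apply (n : ℕ) (i j : Fin n) :
    typeB n i j =
      if i = j then 1
      else if (i : ℕ) = 0 ∧ (j : ℕ) = 1 ∨ (i : ℕ) = 1 ∧ (j : ℕ) = 0 then 4
      else if (i : ℕ) + 1 = j ∨ (j : ℕ) + 1 = i then 3
      else 2 := by
  have hi := i.isLt
  have hj := j.isLt
  simp only [typeB, CoxeterMatrix.reindex_apply, CoxeterMatrix.B, Matrix.of_apply,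
    Fin.revPerm_symm, Fin.revPerm_apply, Fin.val_rev, Fin.ext_iff]
  split_ifs <;> omega

variable {n : ℕ} {M : CoxeterMatrix (Fin n)} {W : Type*} [Group W]

/-- The standard parabolic subgroup `W_J`, generated by the simple reflections in `J`. -/
def parabolic (cs : CoxeterSystem M W) (J : Set (Fin n)) : Subgroup W :=
  Subgroup.closure (cs.simple '' J)

/-- The parabolic quotient `^I W_J = {w ∈ W_J : ℓ(s w) > ℓ(w) for all s ∈ I}`. -/
def quotient (cs : CoxeterSystem M W) (I J : Set (Fin n)) : Set W :=
  {w | w ∈ parabolic cs J ∧ ∀ s ∈ I, cs.length w < cs.length (cs.simple s * w)}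

/-- `f = (w^{(1)}, …, w^{(n)})` is a factorization `w = w^{(1)} w^{(2)} ⋯ w^{(n)}` of `w` with
`w^{(i)}` in the quotient of `W_{s_1, …, s_i}` by `{s_1, …, s_{i-1}}` for all `i`. -/
def IsFactorization (cs : CoxeterSystem M W) (w : W) (f : Fin n → W) : Prop :=
  (∀ i, f i ∈ quotient cs (Set.Iio i) (Set.Iic i)) ∧ (List.ofFn f).prod = w

/-- The Bruhat order, defined by the subword property: `u ≤ v` if some reduced word of `v` has a
subword which is a reduced word of `u`. -/
def BruhatLE (cs : CoxeterSystem M W) (u v : W) : Prop :=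
  ∃ ω ω' : List (Fin n), cs.IsReduced ω ∧ cs.wordProd ω = v ∧
    ω'.Sublist ω ∧ cs.IsReduced ω' ∧ cs.wordProd ω' = u

/-- `W(q) = ∑_{w ∈ W} q^{ℓ(w)}` (meant for finite `W`). -/
noncomputable def poincarePolynomial (cs : CoxeterSystem M W) : ℕ[X] :=
  ∑ᶠ w : W, X ^ cs.length w

/-- `e_1, …, e_n` are the exponents of `(W, S)`: positive integers, as many as there are simple
reflections, with `W(q) = ∏_i (1 + q + ⋯ + q^{e_i})`. -/
def IsExponents (cs : CoxeterSystem M W) (e : Fin n → ℕ) : Prop :=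
  (∀ i, 0 < e i) ∧
    poincarePolynomial cs = ∏ i, ∑ k ∈ Finset.range (e i + 1), (X : ℕ[X]) ^ k

/-- A bijection `L : W → ∏_i {0, …, e_i}`, where `(W, S)` is a finite Coxeter system with exponents
`e_1, …, e_n`, is a Lehmer code if its inverse is order preserving from the componentwise order to
the Bruhat order. -/
structure IsLehmerCode (cs : CoxeterSystem M W) (e : Fin n → ℕ)
    (L : W ≃ ((i : Fin n) → Fin (e i + 1))) : Prop where
  finite : Finite W
  exponents : IsExponents cs e
  monotone : ∀ a b : (i : Fin n) → Fin (e i + 1), a ≤ b → BruhatLE cs (L.symm a) (L.symm b)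

end LehmerCode

/-!
For each `i`, consider the word `c_i = s_i s_{i-1} ⋯ s_1 s_2 ⋯ s_i` of length `2i - 1`. The quotient
`Q_i` is the chain of the `2i` prefixes of `c_i`, so that `w` is recovered from its code `a` as the
product of the prefixes of length `a_i` of the words `c_i`. Enlarging the code enlarges each prefix,
so the word obtained for `a` is a subword of the word obtained for `b ≥ a`. Everything follows once
these words are known to be reduced and to represent each element exactly once.

Existence (`exists_mul_chain`) is a computation with braid relations: a generator `s_j` with
`j ≤ i`, multiplied on the right to a prefix of `c_i`, either prolongs it, shortens it, or can be
moved to the left past it, where it becomes a generator `s_{j'}` with `j' < i` (`chain_mul_gen`).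
The same computation shows that the whole of `c_i` commutes with `s_1, …, s_{i-1}`.

Length additivity (`length_mul_chain`) comes from the longest element. The product
`c_1 c_2 ⋯ c_i` acts as `-1` on `±1, …, ±i` in the signed permutation representation, so it has
`i²` inversions, and as a simple reflection creates at most one inversion
(`card_inversions_signedSwap_mul_le`), its length is at least `i²`, the number of letters of its
word. Every product of prefixes can be completed to `c_1 c_2 ⋯ c_i` by as many letters as it lacks,
thanks to the commutation just mentioned (`exists_mul_eq_longest`); hence its own word is reduced.
Uniqueness follows from additivity of lengths (`mul_chain_injective`): if `u p = v q` with prefixes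
`p`, `q` of `c_i` and `u`, `v` in the subgroup generated by `s_1, …, s_{i-1}`, then comparing the
lengths of `v⁻¹ u p = q` and `u⁻¹ v q = p` gives `u = v`.

In the code below generators are numbered from `0`: `gen cs j` is `s_{j+1}`, and `chain cs i a` is
the prefix of length `a` of `c_{i+1}`.
-/

namespace LehmerCode

/-! ### Signed permutations -/

/-- The underlying function of `signedSwap j`. -/
def signedSwapFun (j : ℕ) (x : ℤ) : ℤ :=
  if j = 0 then (if x = 1 ∨ x = -1 then -x else x)
  else if x = j then j + 1 else if x = j + 1 then j
  else if x = -j then -(j + 1) else if x = -(j + 1) then -j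
  else x

theorem signedSwapFun_involutive (j : ℕ) : Function.Involutive (signedSwapFun j) := by
  intro x
  unfold signedSwapFun
  split_ifs <;> omega

/-- The permutation of `ℤ` by which `s_{j+1}` acts in the realization of the group of type `B` by
odd permutations: for `j = 0` it exchanges `1` and `-1`, for `j > 0` it exchanges `j` with `j + 1`
and `-j` with `-(j + 1)`. -/
def signedSwap (j : ℕ) : Equiv.Perm ℤ :=
  (signedSwapFun_involutive j).toPerm

theorem signedSwap_apply (j : ℕ) (x : ℤ) : signedSwap j x = signedSwapFun j x := rfl

theorem signedSwap_mul_self (j : ℕ) : signedSwap j * signedSwap j = 1 :=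
  Equiv.ext (signedSwapFun_involutive j)

theorem signedSwap_neg (j : ℕ) (x : ℤ) : signedSwap j (-x) = -signedSwap j x := by
  simp only [signedSwap_apply, signedSwapFun]
  split_ifs <;> omega

theorem signedSwap_zero_eq : signedSwap 0 = Equiv.swap 1 (-1) := by
  ext x
  simp only [signedSwap_apply, signedSwapFun, Equiv.swap_apply_def]
  split_ifs <;> omega

theorem signedSwap_eq {j : ℕ} (h : j ≠ 0) :
    signedSwap j = Equiv.swap (j : ℤ) (j + 1) * Equiv.swap (-j : ℤ) (-(j + 1)) := by
  ext x
  simp only [signedSwap_apply, signedSwapFun, Equiv.Perm.mul_apply,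
    Equiv.swap_apply_def (-j : ℤ)]
  split_ifs <;> rw [Equiv.swap_apply_def] <;> split_ifs <;> omega

theorem signedSwap_conj (f : Equiv.Perm ℤ) {j : ℕ} (h : j ≠ 0) :
    f * signedSwap j * f⁻¹ =
      Equiv.swap (f j) (f (j + 1)) * Equiv.swap (f (-j)) (f (-(j + 1))) := by
  rw [signedSwap_eq h, Equiv.swap_apply_apply, Equiv.swap_apply_apply]
  group

theorem signedSwap_inv (j : ℕ) : (signedSwap j)⁻¹ = signedSwap j :=
  inv_eq_of_mul_eq_one_left (signedSwap_mul_self j)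

theorem signedSwap_comm {j k : ℕ} (h : j + 2 ≤ k) :
    signedSwap j * signedSwap k = signedSwap k * signedSwap j := by
  rw [← mul_inv_eq_iff_eq_mul, signedSwap_conj _ (by omega), signedSwap_eq (j := k) (by omega)]
  have h₁ : signedSwap j k = k := by
    simp only [signedSwap_apply, signedSwapFun]
    split_ifs <;> grind
  have h₂ : signedSwap j (k + 1) = k + 1 := by
    simp only [signedSwap_apply, signedSwapFun]
    split_ifs <;> omega
  rw [signedSwap_neg, signedSwap_neg, h₁, h₂]

theorem signedSwap_braid {j : ℕ} (h : j ≠ 0) :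
    signedSwap j * signedSwap (j + 1) * signedSwap j =
      signedSwap (j + 1) * signedSwap j * signedSwap (j + 1) := by
  have h₁ : signedSwap j (j + 1 : ℕ) = j := by simp [signedSwap_apply, signedSwapFun, h]
  have h₂ : signedSwap j ((j + 1 : ℕ) + 1) = j + 2 := by
    simp only [signedSwap_apply, signedSwapFun]
    split_ifs <;> omega
  have h₃ : signedSwap (j + 1) j = j := by
    simp only [signedSwap_apply, signedSwapFun]
    split_ifs <;> grind
  have h₄ : signedSwap (j + 1) (j + 1) = j + 2 := by
    simp only [signedSwap_apply, signedSwapFun]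
    split_ifs <;> grind
  have h₅ := signedSwap_conj (signedSwap j) (Nat.add_one_ne_zero j)
  have h₆ := signedSwap_conj (signedSwap (j + 1)) h
  rw [signedSwap_inv, signedSwap_neg, signedSwap_neg] at h₅ h₆
  rw [h₅, h₆, h₁, h₂, h₃, h₄]

theorem signedSwap_braid_four :
    signedSwap 0 * signedSwap 1 * signedSwap 0 * signedSwap 1 =
      signedSwap 1 * signedSwap 0 * signedSwap 1 * signedSwap 0 := by
  -- `signedSwap 1 * signedSwap 0 * signedSwap 1` exchanges `2` and `-2`, and
  -- `signedSwap 0` fixes both.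
  have h : signedSwap 1 * signedSwap 0 * signedSwap 1 = Equiv.swap 2 (-2) := by
    have := Equiv.swap_apply_apply (signedSwap 1) 1 (-1)
    rw [signedSwap_inv, ← signedSwap_zero_eq] at this
    rw [← this]
    congr 1
  have h' : signedSwap 0 * Equiv.swap 2 (-2) * (signedSwap 0)⁻¹ = Equiv.swap 2 (-2) := by
    rw [← Equiv.swap_apply_apply]
    congr 1
  rw [h, ← h', inv_mul_cancel_right, ← h]
  group

/-- The only pairs whose order is reversed by `signedSwap j`, zero being left aside. -/
theorem signedSwap_lt {j : ℕ} {x y : ℤ} (hx : x ≠ 0) (hy : y ≠ 0) (hxy : x < y)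
    (h : signedSwap j y < signedSwap j x) :
    y = j + 1 ∧ x = (if j = 0 then -1 else (j : ℤ)) ∨
      x = -(j + 1) ∧ y = -(if j = 0 then -1 else (j : ℤ)) := by
  simp only [signedSwap_apply, signedSwapFun] at h
  split_ifs at * <;> omega

/-! ### Inversions of signed permutations -/

/-- The smaller entry of the pair of integers indexed by `p`. The positive roots of type `B_m` are
encoded by pairs `a < b` of integers with `0 < b ≤ m`, `a ≠ 0` and `-b ≤ a`, and these are indexed
by `Fin m × Fin m`: the index `(u, v)` stands for `(u + 1, v + 1)` if `u < v` and for
`(-(v + 1), u + 1)` otherwise. -/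
def pairFst {m : ℕ} (p : Fin m × Fin m) : ℤ :=
  if p.1 < p.2 then (p.1 : ℤ) + 1 else -((p.2 : ℤ) + 1)

/-- The larger entry of the pair of integers indexed by `p`, see `pairFst`. -/
def pairSnd {m : ℕ} (p : Fin m × Fin m) : ℤ :=
  if p.1 < p.2 then (p.2 : ℤ) + 1 else (p.1 : ℤ) + 1

theorem pair_bounds {m : ℕ} (p : Fin m × Fin m) :
    pairFst p ≠ 0 ∧ pairFst p < pairSnd p ∧ -pairSnd p ≤ pairFst p ∧ 0 < pairSnd p ∧
      pairSnd p ≤ m := by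
  have h₁ := p.1.isLt
  have h₂ := p.2.isLt
  simp only [pairFst, pairSnd, Fin.lt_def]
  split_ifs <;> omega

theorem pair_injective {m : ℕ} {p q : Fin m × Fin m} (h₁ : pairFst p = pairFst q)
    (h₂ : pairSnd p = pairSnd q) : p = q := by
  simp only [pairFst, pairSnd, Fin.lt_def] at h₁ h₂
  ext
  · split_ifs at * <;> omega
  · split_ifs at * <;> omega

/-- The inversions of `y` on `±1, …, ±m`: the pairs `a < b` of `pairFst` with `y b < y a`. -/
def inversions (m : ℕ) (y : Equiv.Perm ℤ) : Finset (Fin m × Fin m) :=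
  Finset.univ.filter fun p => y (pairSnd p) < y (pairFst p)

theorem mem_inversions {m : ℕ} {y : Equiv.Perm ℤ} {p : Fin m × Fin m} :
    p ∈ inversions m y ↔ y (pairSnd p) < y (pairFst p) := by
  simp [inversions]

theorem inversions_one (m : ℕ) : inversions m 1 = ∅ := by
  ext p
  have := pair_bounds p
  simp only [mem_inversions, Equiv.Perm.one_apply, Finset.notMem_empty, iff_false]
  omega

/-- Multiplication by `signedSwap j` creates at most one inversion: the values that it exchanges
occur, up to a common sign, at a single pair of positions. -/
theorem card_inversions_signedSwap_mul_le (m j : ℕ) (y : Equiv.Perm ℤ)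
    (hy : ∀ x, y (-x) = -y x) :
    (inversions m (signedSwap j * y)).card ≤ (inversions m y).card + 1 := by
  have hy₀ : ∀ x, x ≠ 0 → y x ≠ 0 := by
    intro x hx h
    have h₀ : y 0 = 0 := by
      have := hy 0
      rw [neg_zero] at this
      omega
    exact hx (y.injective (h.trans h₀.symm))
  rw [← Nat.sub_le_iff_le_add']
  refine (Finset.le_card_sdiff _ _).trans (Finset.card_le_one.2 ?_)
  have key : ∀ p ∈ inversions m (signedSwap j * y) \ inversions m y,
      y (pairSnd p) = j + 1 ∧ y (pairFst p) = (if j = 0 then -1 else (j : ℤ)) ∨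
      y (pairFst p) = -(j + 1) ∧ y (pairSnd p) = -(if j = 0 then -1 else (j : ℤ)) := by
    intro p hp
    have hb := pair_bounds p
    simp only [Finset.mem_sdiff, mem_inversions, not_lt, Equiv.Perm.mul_apply] at hp
    refine signedSwap_lt (hy₀ _ hb.1) (hy₀ _ (by omega)) (lt_of_le_of_ne hp.2 fun h => ?_) hp.1
    exact hb.2.1.ne (y.injective h)
  have aux : ∀ p q : Fin m × Fin m, y (pairFst p) = -y (pairSnd q) →
      y (pairSnd p) = -y (pairFst q) → p = q := by
    intro p q h₁ h₂
    rw [← hy] at h₁ h₂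
    have h₁ := y.injective h₁
    have h₂ := y.injective h₂
    have hp := pair_bounds p
    have hq := pair_bounds q
    exact pair_injective (by omega) (by omega)
  intro p hp q hq
  rcases key p hp with ⟨h₁, h₂⟩ | ⟨h₁, h₂⟩ <;> rcases key q hq with ⟨h₃, h₄⟩ | ⟨h₃, h₄⟩
  · exact pair_injective (y.injective (h₂.trans h₄.symm)) (y.injective (h₁.trans h₃.symm))
  · exact aux p q (by rw [h₂, h₄, neg_neg]) (by rw [h₁, h₃, neg_neg])
  · exact aux p q (by rw [h₁, h₃]) (by rw [h₂, h₄])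
  · exact pair_injective (y.injective (h₁.trans h₃.symm)) (y.injective (h₂.trans h₄.symm))

theorem card_inversions_of_eq_neg (m : ℕ) (y : Equiv.Perm ℤ)
    (hy : ∀ x : ℤ, -m ≤ x → x ≤ m → y x = -x) : (inversions m y).card = m ^ 2 := by
  have : inversions m y = Finset.univ := by
    refine Finset.filter_true_of_mem fun p _ => ?_
    have := pair_bounds p
    rw [hy _ (by omega) (by omega), hy _ (by omega) (by omega)]
    omega
  rw [this, Finset.card_univ, Fintype.card_prod, Fintype.card_fin, sq]

/-! ### The signed permutation representation -/

variable {n : ℕ} {W : Type*} [Group W]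

theorem signedSwap_isLiftable (n : ℕ) :
    (typeB n).IsLiftable fun i : Fin n => signedSwap i := by
  have braid : ∀ a b : Equiv.Perm ℤ, a * a = 1 → b * b = 1 → a * b * a = b * a * b →
      (a * b) ^ 3 = 1 := by
    intro a b ha hb h
    calc (a * b) ^ 3 = a * b * a * (b * a * b) := by simp only [pow_succ, pow_zero]; group
      _ = a * b * (a * a) * b * a := by rw [← h]; group
      _ = 1 := by rw [ha, mul_one, mul_assoc a, hb, mul_one, ha]
  have braid_four : ∀ a b : Equiv.Perm ℤ, a * a = 1 → b * b = 1 →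
      a * b * a * b = b * a * b * a → (a * b) ^ 4 = 1 := by
    intro a b ha hb h
    calc (a * b) ^ 4 = a * b * a * b * (a * b * a * b) := by
          simp only [pow_succ, pow_zero]; group
      _ = a * b * a * (b * b) * a * b * a := by rw [h]; nth_rw 1 [← h]; group
      _ = a * b * (a * a) * b * a := by rw [hb]; group
      _ = 1 := by rw [ha, mul_one, mul_assoc a, hb, mul_one, ha]
  have comm : ∀ a b : Equiv.Perm ℤ, a * a = 1 → b * b = 1 → a * b = b * a → (a * b) ^ 2 = 1 := by
    intro a b ha hb h
    rw [(show Commute a b from h).mul_pow, sq, sq, ha, hb, one_mul]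
  intro i j
  have hi := signedSwap_mul_self i
  have hj := signedSwap_mul_self j
  rw [typeB_apply]
  split_ifs with h₁ h₂ h₃
  · rw [h₁, pow_one, hj]
  · apply braid_four _ _ hi hj
    rcases h₂ with ⟨h, h'⟩ | ⟨h, h'⟩ <;> rw [h, h']
    · exact signedSwap_braid_four
    · exact signedSwap_braid_four.symm
  · apply braid _ _ hi hj
    rcases h₃ with h | h <;> rw [← h]
    · exact signedSwap_braid (by omega)
    · exact (signedSwap_braid (by omega)).symm
  · apply comm _ _ hi hj
    have h₄ : (i : ℕ) ≠ j := fun h => h₁ (Fin.ext h)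
    rcases Nat.lt_or_gt_of_ne h₄ with h | h
    · exact signedSwap_comm (by omega)
    · exact (signedSwap_comm (by omega)).symm

/-- The action of a Coxeter group of type `B` on `ℤ` by signed permutations. -/
noncomputable def signedPerm (cs : CoxeterSystem (typeB n) W) : W →* Equiv.Perm ℤ :=
  cs.lift ⟨_, signedSwap_isLiftable n⟩

theorem signedPerm_simple (cs : CoxeterSystem (typeB n) W) (i : Fin n) :
    signedPerm cs (cs.simple i) = signedSwap i :=
  cs.lift_apply_simple (signedSwap_isLiftable n) i

theorem signedPerm_neg (cs : CoxeterSystem (typeB n) W) (w : W) (x : ℤ) :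
    signedPerm cs w (-x) = -signedPerm cs w x := by
  induction w using cs.simple_induction_left with
  | one => simp
  | mul_simple_left w i ih => simp [signedPerm_simple, ih, signedSwap_neg]

/-- The number of inversions bounds the length from below. -/
theorem card_inversions_le_length (cs : CoxeterSystem (typeB n) W) (m : ℕ) (w : W) :
    (inversions m (signedPerm cs w)).card ≤ cs.length w := by
  obtain ⟨ω, hω, rfl⟩ := cs.exists_isReduced w
  rw [hω.eq]
  clear hω
  induction ω with
  | nil => simp [inversions_one]
  | cons i ω ih =>
    rw [cs.wordProd_cons, map_mul, signedPerm_simple, List.length_cons]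
    exact (card_inversions_signedSwap_mul_le m i _ (signedPerm_neg cs _)).trans (by omega)

/-! ### Chains of generators -/

section Chain

variable [NeZero n] (cs : CoxeterSystem (typeB n) W)

theorem typeB_ofNat (n : ℕ) [NeZero n] {j k : ℕ} (hj : j < n) (hk : k < n) :
    typeB n (Fin.ofNat n j) (Fin.ofNat n k) =
      if j = k then 1
      else if j = 0 ∧ k = 1 ∨ j = 1 ∧ k = 0 then 4
      else if j + 1 = k ∨ k + 1 = j then 3
      else 2 := by
  simp only [typeB_apply, Fin.ext_iff, Fin.val_ofNat, Nat.mod_eq_of_lt hj, Nat.mod_eq_of_lt hk]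

/-- The generator `s_{j+1}`, indexed by natural numbers; only the values `j < n` matter. -/
def gen (j : ℕ) : W := cs.simple (Fin.ofNat n j)

theorem gen_mul_self (j : ℕ) : gen cs j * gen cs j = 1 := cs.simple_mul_simple_self _

theorem gen_inv (j : ℕ) : (gen cs j)⁻¹ = gen cs j := cs.inv_simple _

theorem gen_mul_gen_pow (j k : ℕ) : (gen cs j * gen cs k) ^
    (typeB n (Fin.ofNat n j) (Fin.ofNat n k)) = 1 := cs.simple_mul_simple_pow _ _

theorem gen_comm {j k : ℕ} (hj : j < n) (hk : k < n) (h : j + 2 ≤ k ∨ k + 2 ≤ j) :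
    gen cs j * gen cs k = gen cs k * gen cs j := by
  have key := gen_mul_gen_pow cs j k
  have : typeB n (Fin.ofNat n j) (Fin.ofNat n k) = 2 := by
    rw [typeB_ofNat n hj hk, if_neg (by omega), if_neg (by omega), if_neg (by omega)]
  rw [this, sq, ← eq_inv_iff_mul_eq_one, mul_inv_rev, gen_inv, gen_inv] at key
  exact key

theorem gen_braid {j : ℕ} (h₀ : j ≠ 0) (hj : j + 1 < n) :
    gen cs j * gen cs (j + 1) * gen cs j = gen cs (j + 1) * gen cs j * gen cs (j + 1) := by
  have key := gen_mul_gen_pow cs j (j + 1)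
  have : typeB n (Fin.ofNat n j) (Fin.ofNat n (j + 1)) = 3 := by
    rw [typeB_ofNat n (by omega) hj, if_neg (by omega), if_neg (by omega), if_pos (by omega)]
  rw [this, show ∀ a b : W, (a * b) ^ 3 = a * b * a * (b * a * b) by
    intro a b; simp only [pow_succ, pow_zero]; group, ← eq_inv_iff_mul_eq_one] at key
  simpa only [mul_inv_rev, gen_inv, mul_assoc] using key

theorem gen_braid_four (hn : 1 < n) :
    gen cs 1 * gen cs 0 * gen cs 1 * gen cs 0 = gen cs 0 * gen cs 1 * gen cs 0 * gen cs 1 := by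
  have key := gen_mul_gen_pow cs 1 0
  have : typeB n (Fin.ofNat n 1) (Fin.ofNat n 0) = 4 := by
    rw [typeB_ofNat n hn (by omega), if_neg (by omega), if_pos (by omega)]
  rw [this, show ∀ a b : W, (a * b) ^ 4 = a * b * a * b * (a * b * a * b) by
    intro a b; simp only [pow_succ, pow_zero]; group, ← eq_inv_iff_mul_eq_one] at key
  simpa only [mul_inv_rev, gen_inv, mul_assoc] using key

/-- The index of the `k`-th letter of the word `s_{i+1} s_i ⋯ s_1 s_2 ⋯ s_{i+1}`, that is
`|i - k|`. -/
def letter (i k : ℕ) : ℕ := (i - k) + (k - i)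

/-- The word formed by the first `a` letters of `s_{i+1} s_i ⋯ s_1 s_2 ⋯ s_{i+1}`. -/
def chainWord (n : ℕ) [NeZero n] (i a : ℕ) : List (Fin n) :=
  (List.range a).map fun k => Fin.ofNat n (letter i k)

/-- The product of the first `a` letters of `s_{i+1} s_i ⋯ s_1 s_2 ⋯ s_{i+1}`. -/
def chain (i a : ℕ) : W := cs.wordProd (chainWord n i a)

@[simp] theorem length_chainWord (i a : ℕ) : (chainWord n i a).length = a := by
  simp [chainWord]

@[simp] theorem chain_zero (i : ℕ) : chain cs i 0 = 1 := by simp [chain, chainWord]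

theorem chain_succ (i a : ℕ) : chain cs i (a + 1) = chain cs i a * gen cs (letter i a) := by
  simp [chain, chainWord, List.range_succ, cs.wordProd_append, gen]

theorem chainWord_succ' (i a : ℕ) :
    chainWord n i (a + 1) = Fin.ofNat n i :: (chainWord n i (a + 1)).tail := by
  simp [chainWord, List.range_succ_eq_map, letter]

theorem chain_succ_succ (i a : ℕ) : chain cs (i + 1) (a + 1) = gen cs (i + 1) * chain cs i a := by
  simp only [chain, chainWord, List.range_succ_eq_map, List.map_cons, List.map_map,
    cs.wordProd_cons, gen]
  congr 3
  · simp [letter]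
  · funext k
    simp [letter, Nat.succ_eq_add_one]

/-- A generator which neither prolongs nor shortens the word of `chain cs i a` can be moved past it
to the left. Comments in the proof write `g j` for `gen cs j`. -/
theorem chain_mul_gen {i : ℕ} (hi : i < n) (a j : ℕ) (ha : a ≤ 2 * i + 1) (hj : j ≤ i)
    (h₁ : j ≠ letter i a) (h₂ : a ≠ 0 → j ≠ letter i (a - 1)) :
    chain cs i a * gen cs j = gen cs (if j < letter i a then j else j - 1) * chain cs i a := by
  induction a using Nat.strong_induction_on generalizing j with
  | _ a ih =>
  rcases a with _ | a
  · have : j < letter i 0 := by unfold letter at *; omega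
    simp [this]
  have h₂ := h₂ (by omega)
  rw [Nat.add_sub_cancel] at h₂
  by_cases hfar : j + 2 ≤ letter i a ∨ letter i a + 2 ≤ j
  · -- `g j` commutes with the last letter
    have e := ih a (by omega) j (by omega) hj (by omega) (by unfold letter at *; omega)
    have hk : letter i a < n := by unfold letter at *; omega
    have hcond : (j < letter i (a + 1)) = (j < letter i a) := by
      unfold letter at *
      apply propext
      omega
    rw [chain_succ, mul_assoc, gen_comm cs hk (by omega) (by omega), ← mul_assoc, e, mul_assoc]
    simp only [hcond]
  rcases Nat.lt_or_ge a i with hai | hai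
  · -- the word descends to `g (k + 1) * g k` with `j = k + 1`, so the braid relation of these two
    -- letters turns the problem into moving `g k` past the word without them
    obtain ⟨b, rfl⟩ : ∃ b, a = b + 1 := ⟨a - 1, by unfold letter at *; omega⟩
    obtain ⟨k, hk⟩ : ∃ k, letter i (b + 1) = k := ⟨_, rfl⟩
    have hk₀ : k ≠ 0 := by unfold letter at *; omega
    have hj' : j = k + 1 := by unfold letter at *; omega
    have hb : letter i b = k + 1 := by unfold letter at *; omega
    have e := ih b (by omega) k (by omega) (by omega) (by omega) (by unfold letter at *; omega)
    have hcond : ¬ j < letter i (b + 1 + 1) := by unfold letter at *; omega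
    rw [if_pos (by omega)] at e
    rw [if_neg hcond, chain_succ, chain_succ, hk, hb, hj', Nat.add_sub_cancel]
    calc chain cs i b * gen cs (k + 1) * gen cs k * gen cs (k + 1)
        = chain cs i b * (gen cs (k + 1) * gen cs k * gen cs (k + 1)) := by
          simp only [mul_assoc]
      _ = chain cs i b * gen cs k * gen cs (k + 1) * gen cs k := by
          rw [← gen_braid cs hk₀ (by omega)]; simp only [mul_assoc]
      _ = gen cs k * (chain cs i b * gen cs (k + 1) * gen cs k) := by
          rw [e]; simp only [mul_assoc]
  · have hai : i < a := by
      rcases Nat.eq_or_lt_of_le hai with h | h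
      · unfold letter at *; omega
      · exact h
    -- past the turning point of the word, only the letter `j = letter i a - 1` is left
    have hcond : j < letter i (a + 1) := by unfold letter at *; omega
    rw [if_pos hcond]
    obtain ⟨b, rfl⟩ : ∃ b, a = b + 1 := ⟨a - 1, by omega⟩
    have hk : letter i (b + 1) = j + 1 := by unfold letter at *; omega
    have hb : letter i b = j := by unfold letter at *; omega
    by_cases hj₀ : j = 0
    · -- the word ends with `g 1 * g 0 * g 1`, and the braid relation of length four applies
      subst hj₀
      obtain ⟨c, rfl⟩ : ∃ c, b = c + 1 := ⟨b - 1, by unfold letter at *; omega⟩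
      have hc : letter i c = 1 := by unfold letter at *; omega
      have e := ih c (by omega) 0 (by omega) (by omega) (by omega) (by unfold letter at *; omega)
      rw [if_pos (by omega)] at e
      rw [chain_succ, chain_succ, chain_succ, hk, hb, hc, zero_add]
      calc chain cs i c * gen cs 1 * gen cs 0 * gen cs 1 * gen cs 0
          = chain cs i c * (gen cs 1 * gen cs 0 * gen cs 1 * gen cs 0) := by
            simp only [mul_assoc]
        _ = chain cs i c * gen cs 0 * gen cs 1 * gen cs 0 * gen cs 1 := by
            rw [gen_braid_four cs (by unfold letter at *; omega)]; simp only [mul_assoc]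
        _ = gen cs 0 * (chain cs i c * gen cs 1 * gen cs 0 * gen cs 1) := by
            rw [e]; simp only [mul_assoc]
    · -- the word ascends to `g j * g (j + 1)`, and the braid relation turns the problem into moving
      -- `g (j + 1)` past the word without these two letters
      have e := ih b (by omega) (j + 1) (by omega) (by unfold letter at *; omega) (by omega)
        (by unfold letter at *; omega)
      rw [if_neg (by omega), Nat.add_sub_cancel] at e
      rw [chain_succ, chain_succ, hk, hb]
      calc chain cs i b * gen cs j * gen cs (j + 1) * gen cs j
          = chain cs i b * (gen cs j * gen cs (j + 1) * gen cs j) := by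
            simp only [mul_assoc]
        _ = chain cs i b * gen cs (j + 1) * gen cs j * gen cs (j + 1) := by
            rw [gen_braid cs hj₀ (by unfold letter at *; omega)]; simp only [mul_assoc]
        _ = gen cs j * (chain cs i b * gen cs j * gen cs (j + 1)) := by
            rw [e]; simp only [mul_assoc]

/-- The full chain `s_{i+1} ⋯ s_1 ⋯ s_{i+1}` commutes with `s_1, …, s_i`. -/
theorem fullChain_mul_gen {i j : ℕ} (hi : i < n) (hj : j < i) :
    chain cs i (2 * i + 1) * gen cs j = gen cs j * chain cs i (2 * i + 1) := by
  have := chain_mul_gen cs hi (2 * i + 1) j le_rfl hj.le (by unfold letter; omega)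
    (fun _ => by unfold letter; omega)
  rwa [if_pos (by unfold letter; omega)] at this

theorem signedPerm_gen {j : ℕ} (hj : j < n) : signedPerm cs (gen cs j) = signedSwap j := by
  rw [gen, signedPerm_simple, Fin.val_ofNat, Nat.mod_eq_of_lt hj]

/-- The full chain acts as the sign change of `i + 1`: it is conjugate to the generator `s_1`. -/
theorem signedPerm_fullChain {i : ℕ} (hi : i < n) :
    signedPerm cs (chain cs i (2 * i + 1)) = Equiv.swap ((i : ℤ) + 1) (-(i + 1)) := by
  induction i with
  | zero =>
    rw [chain_succ, chain_zero, one_mul, letter]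
    exact (signedPerm_gen cs hi).trans signedSwap_zero_eq
  | succ i ih =>
    have hl : letter (i + 1) (2 * i + 2) = i + 1 := by unfold letter; omega
    have h₁ : signedSwap (i + 1) (i + 1) = i + 1 + 1 := by
      simp only [signedSwap_apply, signedSwapFun]
      split_ifs <;> grind
    have h₂ := Equiv.swap_apply_apply (signedSwap (i + 1)) (i + 1) (-(i + 1))
    rw [signedSwap_inv, signedSwap_neg, h₁] at h₂
    rw [show 2 * (i + 1) + 1 = 2 * i + 1 + 1 + 1 by ring, chain_succ, chain_succ_succ, hl,
      map_mul, map_mul, signedPerm_gen cs hi, ih (by omega), ← h₂]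
    push_cast
    rfl

end Chain

/-! ### Length additivity -/

/-- The parabolic subgroup generated by the first `i` simple reflections. -/
def initial (cs : CoxeterSystem (typeB n) W) (i : ℕ) : Subgroup W :=
  parabolic cs {j : Fin n | (j : ℕ) < i}

theorem initial_mono (cs : CoxeterSystem (typeB n) W) {i j : ℕ} (h : i ≤ j) :
    initial cs i ≤ initial cs j :=
  Subgroup.closure_mono (Set.image_mono fun _ hk => lt_of_lt_of_le hk h)

theorem initial_zero (cs : CoxeterSystem (typeB n) W) : initial cs 0 = ⊥ := by
  simp [initial, parabolic]

theorem initial_top (cs : CoxeterSystem (typeB n) W) : initial cs n = ⊤ := by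
  simp [initial, parabolic, cs.subgroup_closure_range_simple]

theorem initial_succ (cs : CoxeterSystem (typeB n) W) (i : Fin n) :
    initial cs (i + 1) = parabolic cs (Set.Iic i) := by
  unfold initial
  congr 1
  ext j
  simp

section Normal

variable [NeZero n] (cs : CoxeterSystem (typeB n) W)

theorem gen_mem_initial {i j : ℕ} (hi : i ≤ n) (hj : j < i) : gen cs j ∈ initial cs i := by
  refine Subgroup.subset_closure ⟨Fin.ofNat n j, ?_, rfl⟩
  rwa [Set.mem_ofPred_eq, Fin.val_ofNat, Nat.mod_eq_of_lt (by omega)]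

/-- An induction principle for membership in `initial cs i`. -/
theorem initial_induction {i : ℕ} {p : (w : W) → w ∈ initial cs i → Prop} (hi : i ≤ n)
    (one : p 1 (one_mem _))
    (mul_gen : ∀ (w : W) (hw : w ∈ initial cs i) (j : ℕ) (hj : j < i), p w hw →
      p (w * gen cs j) (mul_mem hw (gen_mem_initial cs hi hj)))
    {w : W} (hw : w ∈ initial cs i) : p w hw := by
  have step : ∀ (x : W) (hx : x ∈ initial cs i) (y : W)
      (hy : y ∈ cs.simple '' {j : Fin n | (j : ℕ) < i}),
      p x hx → p (x * y) (mul_mem hx (Subgroup.subset_closure hy)) := by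
    rintro x hx _ ⟨j, hj, rfl⟩ h
    have : cs.simple j = gen cs j := by simp [gen]
    simp only [this]
    exact mul_gen x hx j hj h
  refine Subgroup.closure_induction_right one step (fun x hx y hy h => ?_) hw
  have : y⁻¹ = y := by
    obtain ⟨j, -, rfl⟩ := hy
    exact cs.inv_simple j
  simp only [this]
  exact step x hx y hy h

theorem chain_mem_initial {i : ℕ} (hi : i < n) {a : ℕ} (ha : a ≤ 2 * i + 1) :
    chain cs i a ∈ initial cs (i + 1) := by
  induction a with
  | zero => simp [one_mem]
  | succ a ih =>
    rw [chain_succ]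
    exact mul_mem (ih (by omega)) (gen_mem_initial cs hi (by unfold letter; omega))

/-- Every element of `⟨s_1, …, s_{i+1}⟩` is the product of an element of `⟨s_1, …, s_i⟩` and a
prefix of `s_{i+1} ⋯ s_1 ⋯ s_{i+1}`. -/
theorem exists_mul_chain {i : ℕ} (hi : i < n) {w : W} (hw : w ∈ initial cs (i + 1)) :
    ∃ u ∈ initial cs i, ∃ a ≤ 2 * i + 1, w = u * chain cs i a := by
  induction hw using initial_induction cs hi with
  | one => exact ⟨1, one_mem _, 0, by omega, by simp⟩
  | mul_gen w _ j hj ih =>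
    obtain ⟨u, hu, a, ha, rfl⟩ := ih
    by_cases h₁ : j = letter i a
    · exact ⟨u, hu, a + 1, by unfold letter at *; omega, by rw [chain_succ, h₁, mul_assoc]⟩
    by_cases h₂ : a ≠ 0 → j ≠ letter i (a - 1)
    · refine ⟨_, mul_mem hu (gen_mem_initial cs hi.le
        (j := if j < letter i a then j else j - 1) ?_), a, ha, ?_⟩
      · unfold letter at *
        split_ifs <;> omega
      · rw [mul_assoc, chain_mul_gen cs hi a j ha (by omega) h₁ h₂, mul_assoc]
    · push Not at h₂
      obtain ⟨b, rfl⟩ := Nat.exists_eq_succ_of_ne_zero h₂.1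
      refine ⟨u, hu, b, by omega, ?_⟩
      rw [h₂.2, Nat.succ_eq_add_one, Nat.add_sub_cancel, chain_succ, mul_assoc, mul_assoc,
        gen_mul_self, mul_one]

/-- The product of the chains of lengths `a 0, …, a (i - 1)`. -/
def chainProd (i : ℕ) (a : ℕ → ℕ) : W := ((List.range i).map fun k => chain cs k (a k)).prod

theorem chainProd_succ (i : ℕ) (a : ℕ → ℕ) :
    chainProd cs (i + 1) a = chainProd cs i a * chain cs i (a i) := by
  simp [chainProd, List.range_succ]

theorem chainProd_congr {i : ℕ} {a b : ℕ → ℕ} (h : ∀ k < i, a k = b k) :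
    chainProd cs i a = chainProd cs i b := by
  unfold chainProd
  congr 1
  exact List.map_congr_left fun k hk => by rw [h k (List.mem_range.1 hk)]

theorem chainProd_mem_initial {i : ℕ} (hi : i ≤ n) {a : ℕ → ℕ} (ha : ∀ k < i, a k ≤ 2 * k + 1) :
    chainProd cs i a ∈ initial cs i := by
  induction i with
  | zero => simp [chainProd, one_mem]
  | succ i ih =>
    rw [chainProd_succ]
    exact mul_mem (initial_mono cs i.le_succ (ih (by omega) fun k hk => ha k (by omega)))
      (chain_mem_initial cs hi (ha i (by omega)))

theorem exists_eq_chainProd {i : ℕ} (hi : i ≤ n) {w : W} (hw : w ∈ initial cs i) :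
    ∃ a : ℕ → ℕ, (∀ k < i, a k ≤ 2 * k + 1) ∧ w = chainProd cs i a := by
  induction i generalizing w with
  | zero =>
    rw [initial_zero, Subgroup.mem_bot] at hw
    exact ⟨fun _ => 0, by simp, by simp [hw, chainProd]⟩
  | succ i ih =>
    obtain ⟨u, hu, b, hb, rfl⟩ := exists_mul_chain cs hi hw
    obtain ⟨a, ha, rfl⟩ := ih (by omega) hu
    refine ⟨Function.update a i b, fun k hk => ?_, ?_⟩
    · rcases eq_or_ne k i with rfl | h
      · simpa using hb
      · simpa [h] using ha k (by omega)
    · rw [chainProd_succ, Function.update_self]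
      congr 1
      exact chainProd_congr cs fun k hk => by rw [Function.update_of_ne (by omega)]

/-- The longest element of `⟨s_1, …, s_i⟩`. -/
def longest (i : ℕ) : W := chainProd cs i fun k => 2 * k + 1

theorem signedPerm_longest {i : ℕ} (hi : i ≤ n) (x : ℤ) :
    signedPerm cs (longest cs i) x = if -i ≤ x ∧ x ≤ i then -x else x := by
  induction i generalizing x with
  | zero =>
    simp only [longest, chainProd, List.range_zero, List.map_nil, List.prod_nil, map_one,
      Equiv.Perm.one_apply]
    split_ifs <;> omega
  | succ i ih =>
    rw [longest, chainProd_succ, map_mul, Equiv.Perm.mul_apply, signedPerm_fullChain cs hi,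
      ← longest, ih (by omega), Equiv.swap_apply_def]
    push_cast
    split_ifs <;> omega

theorem sq_le_length_longest {i : ℕ} (hi : i ≤ n) : i ^ 2 ≤ cs.length (longest cs i) := by
  rw [← card_inversions_of_eq_neg i (signedPerm cs (longest cs i))]
  · exact card_inversions_le_length cs i _
  · intro x h₁ h₂
    rw [signedPerm_longest cs hi, if_pos ⟨h₁, h₂⟩]

theorem fullChain_mul_comm {i : ℕ} (hi : i < n) {w : W} (hw : w ∈ initial cs i) :
    chain cs i (2 * i + 1) * w = w * chain cs i (2 * i + 1) := by
  induction hw using initial_induction cs hi.le with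
  | one => simp
  | mul_gen w _ j hj ih => rw [← mul_assoc, ih, mul_assoc, fullChain_mul_gen cs hi hj, mul_assoc]

/-- A prefix of a full chain is completed to the full chain by as many letters as it lacks. -/
theorem exists_chain_mul_eq_fullChain {i : ℕ} (hi : i < n) {a : ℕ} (ha : a ≤ 2 * i + 1) :
    ∃ r ∈ initial cs (i + 1), chain cs i a * r = chain cs i (2 * i + 1) ∧
      cs.length r ≤ 2 * i + 1 - a := by
  refine Nat.decreasingInduction' (P := fun a => ∃ r ∈ initial cs (i + 1),
    chain cs i a * r = chain cs i (2 * i + 1) ∧ cs.length r ≤ 2 * i + 1 - a) ?_ ha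
    ⟨1, one_mem _, by simp, by simp⟩
  rintro k hk - ⟨r, hr, h, hl⟩
  refine ⟨gen cs (letter i k) * r,
    mul_mem (gen_mem_initial cs hi (by unfold letter; omega)) hr, ?_, ?_⟩
  · rw [← mul_assoc, ← chain_succ, h]
  · have := cs.length_mul_le (gen cs (letter i k)) r
    rw [gen, cs.length_simple, ← gen] at this
    omega

/-- Every element `u` of `⟨s_1, …, s_i⟩` can be completed to the longest element by a factor `z`
whose length is the deficit of `u`. -/
theorem exists_mul_eq_longest {i : ℕ} (hi : i ≤ n) {u : W} (hu : u ∈ initial cs i) :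
    ∃ z ∈ initial cs i, u * z = longest cs i ∧ cs.length u + cs.length z ≤ i ^ 2 := by
  induction i generalizing u with
  | zero =>
    rw [initial_zero, Subgroup.mem_bot] at hu
    exact ⟨1, one_mem _, by simp [hu, longest, chainProd], by simp [hu]⟩
  | succ i ih =>
    obtain ⟨v, hv, a, ha, rfl⟩ := exists_mul_chain cs hi hu
    obtain ⟨z, hz, hvz, hl⟩ := ih (by omega) hv
    obtain ⟨r, hr, har, hlr⟩ := exists_chain_mul_eq_fullChain cs hi ha
    refine ⟨r * z, mul_mem hr (initial_mono cs i.le_succ hz), ?_, ?_⟩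
    · calc v * chain cs i a * (r * z) = v * (chain cs i a * r * z) := by simp only [mul_assoc]
        _ = v * z * chain cs i (2 * i + 1) := by
          rw [har, fullChain_mul_comm cs hi hz, mul_assoc]
        _ = longest cs (i + 1) := by rw [hvz, longest, longest, chainProd_succ]
    · have h₁ := cs.length_mul_le r z
      have h₂ := cs.length_mul_le v (chain cs i a)
      have h₃ : cs.length (chain cs i a) ≤ a :=
        (cs.length_wordProd_le _).trans_eq (length_chainWord i a)
      have h₄ : (i + 1) ^ 2 = i ^ 2 + 2 * i + 1 := by ring
      omega

/-- Lengths add up in the decomposition of `exists_mul_chain`: completing both factors gives the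
longest element, whose length leaves no room for a shortening. -/
theorem length_mul_chain {i : ℕ} (hi : i < n) {u : W} (hu : u ∈ initial cs i) {a : ℕ}
    (ha : a ≤ 2 * i + 1) : cs.length (u * chain cs i a) = cs.length u + a := by
  have h₃ : cs.length (chain cs i a) ≤ a :=
    (cs.length_wordProd_le _).trans_eq (length_chainWord i a)
  refine le_antisymm ((cs.length_mul_le _ _).trans (by omega)) ?_
  obtain ⟨z, hz, huz, hl⟩ := exists_mul_eq_longest cs hi.le hu
  obtain ⟨r, hr, har, hlr⟩ := exists_chain_mul_eq_fullChain cs hi ha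
  have key : u * chain cs i a * (r * z) = longest cs (i + 1) := by
    calc u * chain cs i a * (r * z) = u * (chain cs i a * r * z) := by simp only [mul_assoc]
      _ = u * z * chain cs i (2 * i + 1) := by
        rw [har, fullChain_mul_comm cs hi hz, mul_assoc]
      _ = longest cs (i + 1) := by rw [huz, longest, longest, chainProd_succ]
  have h₁ := cs.length_mul_le r z
  have h₂ := cs.length_mul_le (u * chain cs i a) (r * z)
  have h₄ : (i + 1) ^ 2 = i ^ 2 + 2 * i + 1 := by ring
  have h₅ := sq_le_length_longest cs hi
  rw [Nat.succ_eq_add_one, ← key] at h₅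
  omega

theorem length_chain {i : ℕ} (hi : i < n) {a : ℕ} (ha : a ≤ 2 * i + 1) :
    cs.length (chain cs i a) = a := by
  simpa using length_mul_chain cs hi (one_mem (initial cs i)) ha

theorem length_chainProd {i : ℕ} (hi : i ≤ n) {a : ℕ → ℕ} (ha : ∀ k < i, a k ≤ 2 * k + 1) :
    cs.length (chainProd cs i a) = ∑ k ∈ Finset.range i, a k := by
  induction i with
  | zero => simp [chainProd]
  | succ i ih =>
    rw [chainProd_succ, Finset.sum_range_succ, length_mul_chain cs hi
      (chainProd_mem_initial cs (by omega) fun k hk => ha k (by omega)) (ha i (by omega)),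
      ih (by omega) fun k hk => ha k (by omega)]

theorem mul_chain_injective {i : ℕ} (hi : i < n) {u v : W} (hu : u ∈ initial cs i)
    (hv : v ∈ initial cs i) {a b : ℕ} (ha : a ≤ 2 * i + 1) (hb : b ≤ 2 * i + 1)
    (h : u * chain cs i a = v * chain cs i b) : u = v ∧ a = b := by
  -- `x = v⁻¹ u` satisfies `ℓ(x) + a = b`, its inverse satisfies `ℓ(x) + b = a`
  have h₁ := length_mul_chain cs hi (mul_mem (inv_mem hv) hu) ha
  have h₂ := length_mul_chain cs hi (mul_mem (inv_mem hu) hv) hb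
  rw [mul_assoc, h, inv_mul_cancel_left, length_chain cs hi hb] at h₁
  rw [mul_assoc, ← h, inv_mul_cancel_left, length_chain cs hi ha] at h₂
  have h₃ : cs.length (v⁻¹ * u) = 0 := by omega
  rw [cs.length_eq_zero_iff, inv_mul_eq_one] at h₃
  exact ⟨h₃.symm, by omega⟩

theorem chainProd_injective {i : ℕ} (hi : i ≤ n) {a b : ℕ → ℕ} (ha : ∀ k < i, a k ≤ 2 * k + 1)
    (hb : ∀ k < i, b k ≤ 2 * k + 1) (h : chainProd cs i a = chainProd cs i b) :
    ∀ k < i, a k = b k := by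
  induction i with
  | zero => simp
  | succ i ih =>
    rw [chainProd_succ, chainProd_succ] at h
    obtain ⟨h₁, h₂⟩ := mul_chain_injective cs hi
      (chainProd_mem_initial cs (by omega) fun k hk => ha k (by omega))
      (chainProd_mem_initial cs (by omega) fun k hk => hb k (by omega))
      (ha i (by omega)) (hb i (by omega)) h
    intro k hk
    rcases Nat.eq_or_lt_of_le (Nat.le_of_lt_succ hk) with rfl | hk
    · exact h₂
    · exact ih (by omega) (fun k hk => ha k (by omega)) (fun k hk => hb k (by omega)) h₁ k hk

/-! ### The parabolic quotients -/

/-- An element of `⟨s_1, …, s_i⟩` without left descents among `s_1, …, s_i` is trivial. -/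
theorem eq_one_of_length_lt {i : ℕ} (hi : i ≤ n) {w : W} (hw : w ∈ initial cs i)
    (h : ∀ j < i, cs.length w < cs.length (gen cs j * w)) : w = 1 := by
  induction i generalizing w with
  | zero => rwa [initial_zero, Subgroup.mem_bot] at hw
  | succ i ih =>
    obtain ⟨u, hu, a, ha, rfl⟩ := exists_mul_chain cs hi hw
    have hu₁ : u = 1 := by
      refine ih (by omega) hu fun j hj => ?_
      have := h j (by omega)
      rw [← mul_assoc, length_mul_chain cs hi hu ha,
        length_mul_chain cs hi (mul_mem (gen_mem_initial cs (by omega) hj) hu) ha] at this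
      omega
    subst hu₁
    rcases a with _ | a
    · simp
    · -- the first letter of a nonempty chain is a left descent
      have h₁ := h i (by omega)
      have h₂ := cs.length_wordProd_le (chainWord n i (a + 1)).tail
      rw [List.length_tail, length_chainWord, Nat.add_sub_cancel] at h₂
      rw [one_mul, length_chain cs hi ha, chain, chainWord_succ', cs.wordProd_cons, gen,
        cs.simple_mul_simple_cancel_left] at h₁
      omega

/-- The quotient `Q_{i+1}` consists of the prefixes of `s_{i+1} ⋯ s_1 ⋯ s_{i+1}`. -/
theorem mem_quotient_iff (i : Fin n) (w : W) :
    w ∈ quotient cs (Set.Iio i) (Set.Iic i) ↔ ∃ a ≤ 2 * (i : ℕ) + 1, w = chain cs i a := by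
  have hgen : ∀ j : Fin n, cs.simple j = gen cs j := fun j => by simp [gen]
  constructor
  · rintro ⟨hw, h⟩
    rw [← initial_succ] at hw
    obtain ⟨u, hu, a, ha, rfl⟩ := exists_mul_chain cs i.isLt hw
    refine ⟨a, ha, ?_⟩
    rw [eq_one_of_length_lt cs i.isLt.le hu fun j hj => ?_, one_mul]
    have h := h ⟨j, hj.trans i.isLt⟩ hj
    rw [hgen, ← mul_assoc, length_mul_chain cs i.isLt hu ha, length_mul_chain cs i.isLt
      (mul_mem (gen_mem_initial cs i.isLt.le hj) hu) ha] at h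
    omega
  · rintro ⟨a, ha, rfl⟩
    refine ⟨initial_succ cs i ▸ chain_mem_initial cs i.isLt ha, fun j hj => ?_⟩
    rw [hgen, length_mul_chain cs i.isLt (gen_mem_initial cs i.isLt.le hj) ha,
      length_chain cs i.isLt ha, ← hgen, cs.length_simple]
    omega

end Normal

/-! ### The code -/

/-- The sequence of the entries of a code, continued by zeros. -/
def codeSeq (a : (i : Fin n) → Fin (2 * (i : ℕ) + 1 + 1)) (k : ℕ) : ℕ :=
  if h : k < n then a ⟨k, h⟩ else 0

theorem codeSeq_apply (a : (i : Fin n) → Fin (2 * (i : ℕ) + 1 + 1)) (i : Fin n) :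
    codeSeq a i = a i := by
  simp [codeSeq]

theorem codeSeq_le (a : (i : Fin n) → Fin (2 * (i : ℕ) + 1 + 1)) (k : ℕ) (hk : k < n) :
    codeSeq a k ≤ 2 * k + 1 := by
  have := (a ⟨k, hk⟩).isLt
  simp only [codeSeq, hk, dif_pos]
  exact Nat.le_of_lt_succ this

section Code

variable [NeZero n] (cs : CoxeterSystem (typeB n) W)

/-- The concatenation of the chain words of lengths `a 0, …, a (i - 1)`. -/
def chainProdWord (n : ℕ) [NeZero n] (i : ℕ) (a : ℕ → ℕ) : List (Fin n) :=
  (List.range i).flatMap fun k => chainWord n k (a k)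

theorem chainProdWord_succ (i : ℕ) (a : ℕ → ℕ) :
    chainProdWord n (i + 1) a = chainProdWord n i a ++ chainWord n i (a i) := by
  simp [chainProdWord, List.range_succ]

theorem wordProd_chainProdWord (i : ℕ) (a : ℕ → ℕ) :
    cs.wordProd (chainProdWord n i a) = chainProd cs i a := by
  induction i with
  | zero => simp [chainProdWord, chainProd]
  | succ i ih => rw [chainProdWord_succ, cs.wordProd_append, ih, chainProd_succ, chain]

theorem length_chainProdWord (i : ℕ) (a : ℕ → ℕ) :
    (chainProdWord n i a).length = ∑ k ∈ Finset.range i, a k := by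
  induction i with
  | zero => simp [chainProdWord]
  | succ i ih => rw [chainProdWord_succ, List.length_append, ih, length_chainWord,
      Finset.sum_range_succ]

theorem isReduced_chainProdWord {a : ℕ → ℕ} (ha : ∀ k < n, a k ≤ 2 * k + 1) :
    cs.IsReduced (chainProdWord n n a) := by
  rw [CoxeterSystem.IsReduced, wordProd_chainProdWord, length_chainProd cs le_rfl ha,
    length_chainProdWord]

theorem chainProdWord_sublist {i : ℕ} {a b : ℕ → ℕ} (h : ∀ k < i, a k ≤ b k) :
    (chainProdWord n i a).Sublist (chainProdWord n i b) := by
  induction i with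
  | zero => simp [chainProdWord]
  | succ i ih =>
    rw [chainProdWord_succ, chainProdWord_succ]
    exact (ih fun k hk => h k (by omega)).append
      ((List.range_sublist.2 (h i (by omega))).map _)

theorem bruhatLE_chainProd {a b : ℕ → ℕ} (hb : ∀ k < n, b k ≤ 2 * k + 1)
    (h : ∀ k < n, a k ≤ b k) : BruhatLE cs (chainProd cs n a) (chainProd cs n b) :=
  ⟨_, _, isReduced_chainProdWord cs hb, wordProd_chainProdWord cs n b, chainProdWord_sublist h,
    isReduced_chainProdWord cs fun k hk => (h k hk).trans (hb k hk), wordProd_chainProdWord cs n a⟩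

/-- The element of the group with a given code. -/
def decode (a : (i : Fin n) → Fin (2 * (i : ℕ) + 1 + 1)) : W := chainProd cs n (codeSeq a)

theorem prod_ofFn_chain (a : (i : Fin n) → Fin (2 * (i : ℕ) + 1 + 1)) :
    (List.ofFn fun i : Fin n => chain cs i (a i)).prod = decode cs a := by
  simp only [decode, chainProd, ← List.map_coe_finRange_eq_range, List.map_map, List.ofFn_eq_map]
  congr 1
  exact List.map_congr_left fun i _ => by simp [codeSeq_apply]

theorem decode_bijective : Function.Bijective (decode cs) := by
  constructor
  · intro a b h
    have := chainProd_injective cs le_rfl (codeSeq_le a) (codeSeq_le b) h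
    funext i
    have := this i i.isLt
    rw [codeSeq_apply, codeSeq_apply] at this
    exact Fin.ext this
  · intro w
    have hw : w ∈ initial cs n := initial_top cs ▸ Subgroup.mem_top w
    obtain ⟨a, ha, rfl⟩ := exists_eq_chainProd cs le_rfl hw
    refine ⟨fun i => ⟨a i, Nat.lt_succ_of_le (ha i i.isLt)⟩, ?_⟩
    exact chainProd_congr cs fun k hk => by simp [codeSeq, hk]

theorem length_decode (a : (i : Fin n) → Fin (2 * (i : ℕ) + 1 + 1)) :
    cs.length (decode cs a) = ∑ i, (a i : ℕ) := by
  rw [decode, length_chainProd cs le_rfl (codeSeq_le a), ← Fin.sum_univ_eq_sum_range]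
  exact Finset.sum_congr rfl fun i _ => codeSeq_apply a i

/-- The code of an element: its entries are the lengths of the chains whose product it is. -/
noncomputable def code : W ≃ ((i : Fin n) → Fin (2 * (i : ℕ) + 1 + 1)) :=
  (Equiv.ofBijective (decode cs) (decode_bijective cs)).symm

theorem code_symm_apply (a : (i : Fin n) → Fin (2 * (i : ℕ) + 1 + 1)) :
    (code cs).symm a = decode cs a := rfl

theorem decode_code (w : W) : decode cs (code cs w) = w := (code cs).symm_apply_apply w

theorem length_eq_sum_code (w : W) : cs.length w = ∑ i, (code cs w i : ℕ) := by
  rw [← length_decode cs, decode_code]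

theorem isFactorization_iff (w : W) (f : Fin n → W) :
    IsFactorization cs w f ↔ f = fun i : Fin n => chain cs i (code cs w i) := by
  constructor
  · rintro ⟨hf, hprod⟩
    choose a ha hfa using fun i => (mem_quotient_iff cs i (f i)).1 (hf i)
    have hf' : f = fun i : Fin n => chain cs i (a i) := funext hfa
    have := prod_ofFn_chain cs fun i => ⟨a i, Nat.lt_succ_of_le (ha i)⟩
    simp only at this
    rw [← hf', hprod, ← code_symm_apply] at this
    rw [this, Equiv.apply_symm_apply, hf']
  · rintro rfl
    refine ⟨fun i => (mem_quotient_iff cs i _).2 ⟨_, by omega, rfl⟩, ?_⟩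
    rw [prod_ofFn_chain, decode_code]

open Polynomial in
theorem poincarePolynomial_typeB :
    poincarePolynomial cs =
      ∏ i : Fin n, ∑ k ∈ Finset.range (2 * (i : ℕ) + 1 + 1), (X : ℕ[X]) ^ k := by
  have h : poincarePolynomial cs =
      ∑ a : (i : Fin n) → Fin (2 * (i : ℕ) + 1 + 1), ∏ i, (X : ℕ[X]) ^ (a i : ℕ) := by
    rw [poincarePolynomial, ← finsum_comp_equiv (code cs).symm, finsum_eq_sum_of_fintype]
    exact Finset.sum_congr rfl fun a _ => by
      rw [code_symm_apply, length_decode, Finset.prod_pow_eq_pow_sum]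
  simp only [h, Finset.sum_range, Finset.prod_univ_sum, Fintype.piFinset_univ]

theorem isLehmerCode_code :
    IsLehmerCode cs (fun i : Fin n => 2 * (i : ℕ) + 1) (code cs) where
  finite := Finite.of_equiv _ (code cs).symm
  exponents := ⟨fun i => Nat.succ_pos _, poincarePolynomial_typeB cs⟩
  monotone a b hab := by
    refine bruhatLE_chainProd cs (codeSeq_le b) fun k hk => ?_
    simp only [codeSeq, hk, dif_pos]
    exact hab ⟨k, hk⟩

end Code

end LehmerCode

theorem mainTheorem8 {n : ℕ} (hn : 2 ≤ n) {W : Type*} [Group W]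
    (cs : CoxeterSystem (LehmerCode.typeB n) W) :
    ∃ factor : W → Fin n → W,
      (∀ (w : W) (f : Fin n → W), LehmerCode.IsFactorization cs w f ↔ f = factor w) ∧
      (∀ w : W, cs.length w = ∑ i, cs.length (factor w i)) ∧
      ∃ L : W ≃ ((i : Fin n) → Fin (2 * (i : ℕ) + 1 + 1)),
        (∀ (w : W) (i : Fin n), (L w i : ℕ) = cs.length (factor w i)) ∧
        LehmerCode.IsLehmerCode cs (fun i : Fin n => 2 * (i : ℕ) + 1) L := by
  have : NeZero n := ⟨by omega⟩
  have hlen : ∀ (w : W) (i : Fin n),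
      (LehmerCode.code cs w i : ℕ) = cs.length (LehmerCode.chain cs i (LehmerCode.code cs w i)) :=
    fun w i => (LehmerCode.length_chain cs i.isLt (by omega)).symm
  refine ⟨fun w i => LehmerCode.chain cs i (LehmerCode.code cs w i),
    LehmerCode.isFactorization_iff cs, fun w => ?_, LehmerCode.code cs, hlen,
    LehmerCode.isLehmerCode_code cs⟩
  simp only [← hlen, LehmerCode.length_eq_sum_code cs w]
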